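/- Let $\Omega\subset\mathbb{R}^2$ be a (bounded) polygonal domain and let $\varepsilon>0$, $\boldsymbol b\in W^{1,\infty}(\Omega)^2$, $a\in L^\infty(\Omega)$ be such that $0<c_0\le \tfrac12\operatorname{div}\boldsymbol b+a$ a.e. in $\Omega$ for a constant $c_0$. Let $\mathscr{T}_h$ be a partition of $\Omega$ into finitely many triangular or rectangular cells. Let $(\cdot,\cdot)$ and $\|\cdot\|$ be the inner product and norm of $L^2(\Omega)$, and for $v\in H^1_0(\Omega)$ and $\boldsymbol q\in L^2(\Omega)^2$ put $$|||v|||^2=\varepsilon\|\nabla v\|^2+\|v\|^2,\qquad |\boldsymbol q|_*=\sup_{w\in H^1_0(\Omega)\setminus\{0\}}\frac{\int_\Omega \boldsymbol q\cdot\nabla w\,dx}{|||w|||}.$$ For $u,v\in H^1_0(\Omega)$ let $$a_h(u,v)=\sum_{T\in\mathscr{T}_h}\Big(\varepsilon(\nabla u,\nabla v)_T+(a u,v)_T+(\nabla_w\cdot(\boldsymbol b u),v)_T\Big),$$ $$(\nabla_w\cdot(\boldsymbol b u),v)_T=-(\boldsymbol b u,\nabla v)_T+\langle \boldsymbol n\cdot\boldsymbol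 b u,v\rangle_{\partial T},$$ where $\boldsymbol n$ is the outward unit normal to $\partial T$ and $\langle\cdot,\cdot\rangle_{\partial T}$ is the duality pairing of $H^{-1/2}(\partial T)$ and $H^{1/2}(\partial T)$. (This is the weak Galerkin bilinear form at the weak functions given by $u$ and $v$: their weak gradients are the gradients, and the stabilization term vanishes because the interior and boundary parts agree on every $\partial T$.) Then there is a constant $C>0$, depending only on $c_0$ and on an upper bound for $\|a\|_{L^\infty(\Omega)}$ (in particular independent of $\varepsilon$ and of $\mathscr{T}_h$), such that $$\inf_{u\in H^1_0(\Omega)\setminus\{0\}}\ \sup_{v\in H^1_0(\Omega)\setminus\{0\}}\frac{a_h(u,v)}{\big(|||u|||+|\boldsymbol b u|_*\big)\,|||v|||}\ \ge\ C .$$ -/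

import Mathlib

open MeasureTheory Set
open scoped ContDiff ENNReal RealInnerProductSpace

noncomputable section

namespace ConvDiff

/-- The Euclidean plane. -/
abbrev Plane : Type := EuclideanSpace ℝ (Fin 2)

/-- A polygonal domain: a nonempty bounded connected open subset of the plane whose boundary is a
finite union of (nondegenerate) segments. -/
structure IsPolygonalDomain (Ω : Set Plane) : Prop where
  isOpen : IsOpen Ω
  isConnected : IsConnected Ω
  isBounded : Bornology.IsBounded Ω
  polygonal : ∃ S : Finset (Plane × Plane),
    (∀ p ∈ S, p.1 ≠ p.2) ∧ frontier Ω = ⋃ p ∈ S, segment ℝ p.1 p.2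

/-- An open, nondegenerate triangle. -/
def IsOpenTriangle (K : Set Plane) : Prop :=
  ∃ p : Fin 3 → Plane, AffineIndependent ℝ p ∧ K = interior (convexHull ℝ (range p))

/-- An open, nondegenerate rectangle (with sides in arbitrary perpendicular directions). -/
def IsOpenRectangle (K : Set Plane) : Prop :=
  ∃ p e f : Plane, e ≠ 0 ∧ f ≠ 0 ∧ ⟪e, f⟫ = 0 ∧
    K = interior (convexHull ℝ {p, p + e, p + f, p + e + f})

/-- A partition of `Ω` into finitely many triangular or rectangular cells. The cells are recorded
as open sets. -/
structure Mesh (Ω : Set Plane) where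
  cells : Finset (Set Plane)
  isCell : ∀ K ∈ cells, IsOpenTriangle K ∨ IsOpenRectangle K
  subset : ∀ K ∈ cells, K ⊆ Ω
  pairwiseDisjoint : ∀ K ∈ cells, ∀ L ∈ cells, K ≠ L → Disjoint K L
  cover : (⋃ K ∈ cells, closure K) = closure Ω

/-- `φ ∈ C_c^∞(Ω)`. -/
structure IsTest (Ω : Set Plane) (φ : Plane → ℝ) : Prop where
  smooth : ContDiff ℝ ∞ φ
  compact : HasCompactSupport φ
  support : tsupport φ ⊆ Ω

/-- `L²(Ω)` -/
abbrev L2 (Ω : Set Plane) : Type := Lp ℝ 2 (volume.restrict Ω)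

/-- `L²(Ω)²` -/
abbrev L2vec (Ω : Set Plane) : Type := Lp Plane 2 (volume.restrict Ω)

/-- The graph `{(φ, ∇φ) : φ ∈ C_c^∞(Ω)}` inside `L²(Ω) × L²(Ω)²`. -/
def testGraph (Ω : Set Plane) : Submodule ℝ (L2 Ω × L2vec Ω) where
  carrier := {p | ∃ φ : Plane → ℝ, IsTest Ω φ ∧
    p.1 =ᵐ[volume.restrict Ω] φ ∧ p.2 =ᵐ[volume.restrict Ω] gradient φ}
  zero_mem' := by
    refine ⟨fun _ => 0, ⟨contDiff_const, ?_, ?_⟩, ?_, ?_⟩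
    · exact HasCompactSupport.zero
    · simp [tsupport]
    · exact Lp.coeFn_zero _ _ _
    · refine (Lp.coeFn_zero _ _ _).trans (Filter.Eventually.of_forall fun x => ?_)
      simp [gradient]
  add_mem' := by
    rintro p q ⟨φ, hφ, h1, h2⟩ ⟨ψ, hψ, k1, k2⟩
    refine ⟨φ + ψ, ⟨hφ.smooth.add hψ.smooth, hφ.compact.add hψ.compact, ?_⟩, ?_, ?_⟩
    · exact (tsupport_add φ ψ).trans (union_subset hφ.support hψ.support)
    · exact (Lp.coeFn_add _ _).trans (h1.add k1)
    · refine (Lp.coeFn_add _ _).trans ((h2.add k2).trans (Filter.Eventually.of_forall fun x => ?_))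
      have a := (hφ.smooth.differentiable (by simp)) x
      have b := (hψ.smooth.differentiable (by simp)) x
      simp [gradient, fderiv_add a b]
  smul_mem' := by
    rintro c p ⟨φ, hφ, h1, h2⟩
    refine ⟨c • φ, ⟨contDiff_const.smul hφ.smooth, hφ.compact.smul_left, ?_⟩, ?_, ?_⟩
    · exact (closure_mono (Function.support_const_smul_subset c φ)).trans hφ.support
    · exact (Lp.coeFn_smul _ _).trans (h1.const_smul c)
    · refine (Lp.coeFn_smul _ _).trans
        ((h2.const_smul c).trans (Filter.Eventually.of_forall fun x => ?_))
      have a := (hφ.smooth.differentiable (by simp)) x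
      simp [gradient, fderiv_const_smul a c]

/-- `H¹₀(Ω)`: the closure of `C_c^∞(Ω)` in the `H¹` norm. An element is recorded as the pair
`(u, ∇u)` of the function and its weak gradient. -/
def H10 (Ω : Set Plane) : Submodule ℝ (L2 Ω × L2vec Ω) :=
  (testGraph Ω).topologicalClosure

variable {Ω : Set Plane}

/-- The underlying function of an element of `H¹₀(Ω)`. -/
def fn (u : H10 Ω) : Plane → ℝ := (u : L2 Ω × L2vec Ω).1

/-- The weak gradient of an element of `H¹₀(Ω)`. -/
def grad (u : H10 Ω) : Plane → Plane := (u : L2 Ω × L2vec Ω).2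

/-- `b ∈ W^{1,∞}(Ω)²`: `b` and all its weak first partial derivatives are in `L^∞(Ω)`. -/
def MemW1Inf (Ω : Set Plane) (b : Plane → Plane) : Prop :=
  MemLp b ∞ (volume.restrict Ω) ∧
  ∃ D : Fin 2 → Fin 2 → Plane → ℝ, ∀ i j, MemLp (D i j) ∞ (volume.restrict Ω) ∧
    ∀ φ, IsTest Ω φ →
      ∫ x in Ω, b x i * fderiv ℝ φ x (EuclideanSpace.single j 1) = - ∫ x in Ω, D i j x * φ x

/-- `d` is the divergence of the vector field `q` on the open set `U` in the sense of
distributions. -/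
def HasDivergence (U : Set Plane) (q : Plane → Plane) (d : Plane → ℝ) : Prop :=
  LocallyIntegrableOn d U ∧
    ∀ φ, IsTest U φ → ∫ x in U, d x * φ x = - ∫ x in U, ⟪q x, gradient φ x⟫

open Classical in
/-- The divergence of `q` on the open set `U`, as a locally integrable function determined
almost everywhere on `U` (and `0` if the distributional divergence is not such a function). -/
def divergence (U : Set Plane) (q : Plane → Plane) : Plane → ℝ :=
  if h : ∃ d, HasDivergence U q d then h.choose else 0

/-- `|||u|||² = ε ‖∇u‖² + ‖u‖²` -/
def energyNorm (ε : ℝ) (u : H10 Ω) : ℝ :=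
  √(ε * (∫ x in Ω, ‖grad u x‖ ^ 2) + ∫ x in Ω, (fn u x) ^ 2)

/-- `|q|_* = sup { ∫_Ω q · ∇w / |||w||| : w ∈ H¹₀(Ω) \ {0} }` -/
def starSeminorm (Ω : Set Plane) (ε : ℝ) (q : Plane → Plane) : ℝ :=
  ⨆ w : {w : H10 Ω // w ≠ 0}, (∫ x in Ω, ⟪q x, grad w.1 x⟫) / energyNorm ε w.1

/-- The supremum in `starSeminorm` is finite for square integrable fields. -/
theorem starSeminorm_bddAbove {ε : ℝ} (hε : 0 < ε) {q : Plane → Plane}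
    (hq : MemLp q 2 (volume.restrict Ω)) :
    BddAbove (range fun w : {w : H10 Ω // w ≠ 0} =>
      (∫ x in Ω, ⟪q x, grad w.1 x⟫) / energyNorm ε w.1) := by
  refine ⟨‖hq.toLp q‖ / √ε, ?_⟩
  rintro _ ⟨⟨w, hw⟩, rfl⟩
  set g : L2vec Ω := (w : L2 Ω × L2vec Ω).2 with hg
  have h1 : (∫ x in Ω, ⟪q x, grad w x⟫) = ⟪hq.toLp q, g⟫ := by
    rw [L2.inner_def]
    refine integral_congr_ae ?_
    filter_upwards [hq.coeFn_toLp] with x hx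
    rw [hx]; rfl
  have h2 : (∫ x in Ω, ‖grad w x‖ ^ 2) = ‖g‖ ^ 2 := by
    rw [← real_inner_self_eq_norm_sq, L2.inner_def]
    refine integral_congr_ae (Filter.Eventually.of_forall fun x => ?_)
    exact (real_inner_self_eq_norm_sq _).symm
  have h3 : √ε * ‖g‖ ≤ energyNorm ε w := by
    refine Real.le_sqrt_of_sq_le ?_
    rw [mul_pow, Real.sq_sqrt hε.le, h2]
    have : 0 ≤ ∫ x in Ω, (fn w x) ^ 2 := integral_nonneg fun x => sq_nonneg _
    linarith
  have h4 : ⟪hq.toLp q, g⟫ ≤ ‖hq.toLp q‖ * ‖g‖ := real_inner_le_norm _ _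
  have hs : 0 < √ε := Real.sqrt_pos.2 hε
  simp only [h1]
  refine div_le_of_le_mul₀ (Real.sqrt_nonneg _) (by positivity) (h4.trans ?_)
  calc ‖hq.toLp q‖ * ‖g‖ = ‖hq.toLp q‖ / √ε * (√ε * ‖g‖) := by field_simp
    _ ≤ _ := mul_le_mul_of_nonneg_left h3 (by positivity)

/-- The duality pairing `⟨n · q, ψ⟩_{∂K}` of `H^{-1/2}(∂K)` and `H^{1/2}(∂K)`, between the normal
trace of a field `q ∈ H(div; K)` and the trace of a function `ψ` with gradient `ψ'`. As usual, the
normal trace in `H^{-1/2}(∂K)` is the one given by the Green formula. -/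
def normalTracePairing (K : Set Plane) (q : Plane → Plane) (ψ : Plane → ℝ) (ψ' : Plane → Plane) :
    ℝ :=
  (∫ x in K, divergence K q x * ψ x) + ∫ x in K, ⟪q x, ψ' x⟫

/-- The weak divergence on a cell: `(∇_w · q, ψ)_K = -(q, ∇ψ)_K + ⟨n · q, ψ⟩_{∂K}`. -/
def weakDivPairing (K : Set Plane) (q : Plane → Plane) (ψ : Plane → ℝ) (ψ' : Plane → Plane) : ℝ :=
  - (∫ x in K, ⟪q x, ψ' x⟫) + normalTracePairing K q ψ ψ'

/-- The weak Galerkin bilinear form on `H¹₀(Ω)`, summed over the cells of the mesh: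
`a_h(u, v) = ε (∇u, ∇v) + (a u, v) + (∇_w · (b u), v)`. An element `u` of `H¹₀(Ω)` is the weak
function whose interior and boundary parts `u₀`, `u_b` are both given by `u`. So its weak gradient
is its gradient and the stabilization term, which is bilinear in the jumps `u₀ - u_b` and
`v₀ - v_b` on the cell boundaries, vanishes. -/
def wgForm (𝒯 : Mesh Ω) (ε : ℝ) (a : Plane → ℝ) (b : Plane → Plane) (u v : H10 Ω) : ℝ :=
  ε * (∑ K ∈ 𝒯.cells, ∫ x in K, ⟪grad u x, grad v x⟫)
    + (∑ K ∈ 𝒯.cells, ∫ x in K, a x * fn u x * fn v x)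
    + ∑ K ∈ 𝒯.cells, weakDivPairing K (fun x => fn u x • b x) (fn v) (grad v)

end ConvDiff

end

/-!
On each cell the Green formula that defines the normal trace turns the weak divergence of `b u` into
its distributional divergence. The identity `div (b u) = (div b) u + b · ∇u` holds on `Ω` for
`u ∈ H¹₀(Ω)`, so the cell contributions add up to integrals over `Ω` (the cells are convex, so their
boundaries are null sets) and the weak Galerkin form is the usual bilinear form, whatever the mesh:
`a_h(u, v) = ε (∇u, ∇v) + (a u, v) + ((div b) u + b · ∇u, v)` (`wgForm_eq`).

The product rule and the Green formula `((div b) u + b · ∇u, v) = -(b u, ∇v)` on `H¹₀(Ω)`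
(`green_H10`) are the same statement. For test functions it is the definition of the distributional
divergence of `b`, applied to the product `u v`; both sides are continuous in the `H¹` norm because
`b` and `div b` are bounded, so it extends by density.

Suppose now that `a_h(u, v) ≤ S |||v|||` for all `v`. Taking `v = u`, the Green formula gives
`a_h(u, u) = ε ‖∇u‖² + ((a + ½ div b) u, u) ≥ min(1, c₀) |||u|||²` (`coercive`), hence
`|||u||| ≤ S / min(1, c₀)`. Taking `v = -w`, it gives
`(b u, ∇w) = ε (∇u, ∇w) + (a u, w) + a_h(u, -w) ≤ ((1 + A) |||u||| + S) |||w|||` for every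
`A ≥ ‖a‖_∞`, hence `|b u|_* ≤ (1 + A) |||u||| + S`. Together
`|||u||| + |b u|_* ≤ ((2 + A) / min(1, c₀) + 1) S` (`energyNorm_add_starSeminorm_le`), which is the
inf-sup inequality.
-/

noncomputable section

namespace ConvDiff

variable {Ω U K : Set Plane}

/-! ### Test functions -/

theorem IsTest.mono {φ : Plane → ℝ} (hφ : IsTest K φ) (h : K ⊆ Ω) : IsTest Ω φ :=
  ⟨hφ.smooth, hφ.compact, hφ.support.trans h⟩

theorem IsTest.mul {φ ψ : Plane → ℝ} (hφ : IsTest Ω φ) (hψ : IsTest Ω ψ) :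
    IsTest Ω (fun x => φ x * ψ x) :=
  ⟨hφ.smooth.mul hψ.smooth, hφ.compact.mul_right, tsupport_mul_subset_left.trans hφ.support⟩

theorem IsTest.eq_zero_of_notMem {φ : Plane → ℝ} (hφ : IsTest Ω φ) {x : Plane} (hx : x ∉ Ω) :
    φ x = 0 :=
  image_eq_zero_of_notMem_tsupport fun h => hx (hφ.support h)

theorem IsTest.gradient_eq_zero_of_notMem {φ : Plane → ℝ} (hφ : IsTest Ω φ) {x : Plane}
    (hx : x ∉ Ω) : gradient φ x = 0 := by
  have : fderiv ℝ φ x = 0 :=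
    image_eq_zero_of_notMem_tsupport fun h => hx (hφ.support (tsupport_fderiv_subset ℝ h))
  simp [gradient, this]

theorem IsTest.continuous_gradient {φ : Plane → ℝ} (hφ : IsTest Ω φ) :
    Continuous (gradient φ) :=
  (LinearIsometryEquiv.continuous _).comp (hφ.smooth.continuous_fderiv (by simp))

theorem IsTest.memLp {φ : Plane → ℝ} (hφ : IsTest Ω φ) (p : ℝ≥0∞) :
    MemLp φ p (volume.restrict Ω) :=
  hφ.smooth.continuous.memLp_of_hasCompactSupport hφ.compact

theorem IsTest.memLp_gradient {φ : Plane → ℝ} (hφ : IsTest Ω φ) (p : ℝ≥0∞) :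
    MemLp (gradient φ) p (volume.restrict Ω) := by
  refine hφ.continuous_gradient.memLp_of_hasCompactSupport ?_
  exact (hφ.compact.fderiv ℝ).comp_left (map_zero _)

theorem IsTest.gradient_mul {φ ψ : Plane → ℝ} (hφ : IsTest Ω φ) (hψ : IsTest Ω ψ) (x : Plane) :
    gradient (fun y => φ y * ψ y) x = φ x • gradient ψ x + ψ x • gradient φ x := by
  have h1 := (hφ.smooth.differentiable (by simp)) x
  have h2 := (hψ.smooth.differentiable (by simp)) x
  simp [gradient, fderiv_fun_mul h1 h2]

/-- A test function, as an element of `H¹₀(Ω)`. -/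
def IsTest.toH10 {φ : Plane → ℝ} (hφ : IsTest Ω φ) : H10 Ω :=
  ⟨((hφ.memLp 2).toLp φ, (hφ.memLp_gradient 2).toLp _),
    Submodule.le_topologicalClosure _
      ⟨φ, hφ, (hφ.memLp 2).coeFn_toLp, (hφ.memLp_gradient 2).coeFn_toLp⟩⟩

theorem IsTest.fn_toH10 {φ : Plane → ℝ} (hφ : IsTest Ω φ) :
    fn hφ.toH10 =ᵐ[volume.restrict Ω] φ :=
  (hφ.memLp 2).coeFn_toLp

theorem IsTest.grad_toH10 {φ : Plane → ℝ} (hφ : IsTest Ω φ) :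
    grad hφ.toH10 =ᵐ[volume.restrict Ω] gradient φ :=
  (hφ.memLp_gradient 2).coeFn_toLp

/-! ### Distributional divergence -/

theorem integrable_test_mul {d φ : Plane → ℝ} (hd : LocallyIntegrableOn d U) (hφ : IsTest U φ) :
    Integrable (fun x => φ x * d x) := by
  have h1 : IntegrableOn d (tsupport φ) := hd.integrableOn_compact_subset hφ.support hφ.compact
  have h2 := h1.continuousOn_mul hφ.smooth.continuous.continuousOn hφ.compact
  rw [integrableOn_iff_integrable_of_support_subset] at h2
  · exact h2
  · exact (Function.support_mul_subset_left _ _).trans (subset_tsupport φ)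

/-- The distributional divergence is unique almost everywhere. -/
theorem HasDivergence.ae_eq (hU : IsOpen U) {q : Plane → Plane} {d d' : Plane → ℝ}
    (h : HasDivergence U q d) (h' : HasDivergence U q d') : d =ᵐ[volume.restrict U] d' := by
  have key := hU.ae_eq_zero_of_integral_contDiff_smul_eq_zero (μ := volume) (h.1.sub h'.1) ?_
  · rw [Filter.EventuallyEq, ae_restrict_iff' hU.measurableSet]
    filter_upwards [key] with x hx hxU
    exact sub_eq_zero.1 (hx hxU)
  · intro φ h1 h2 h3
    have hφ : IsTest U φ := ⟨h1, h2, h3⟩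
    have e : ∀ f : Plane → ℝ, ∫ x, φ x * f x = ∫ x in U, f x * φ x := fun f => by
      rw [setIntegral_eq_integral_of_forall_compl_eq_zero]
      · simp only [mul_comm]
      · intro x hx
        rw [hφ.eq_zero_of_notMem hx, mul_zero]
    simp only [smul_eq_mul, Pi.sub_apply, mul_sub]
    rw [integral_sub (integrable_test_mul h.1 hφ) (integrable_test_mul h'.1 hφ), e, e, h.2 φ hφ,
      h'.2 φ hφ, sub_self]

theorem HasDivergence.congr {q q' : Plane → Plane} {d d' : Plane → ℝ}
    (h : HasDivergence U q d) (hq : q =ᵐ[volume.restrict U] q') (hd : d =ᵐ[volume.restrict U] d')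
    (hd' : IntegrableOn d' U) : HasDivergence U q' d' := by
  refine ⟨hd'.locallyIntegrableOn, fun φ hφ => ?_⟩
  have e1 : ∫ x in U, d' x * φ x = ∫ x in U, d x * φ x :=
    integral_congr_ae (by filter_upwards [hd] with x hx; rw [hx])
  have e2 : ∫ x in U, ⟪q' x, gradient φ x⟫ = ∫ x in U, ⟪q x, gradient φ x⟫ :=
    integral_congr_ae (by filter_upwards [hq] with x hx; rw [hx])
  rw [e1, e2, h.2 φ hφ]

theorem hasDivergence_divergence {q : Plane → Plane} (h : ∃ d, HasDivergence U q d) :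
    HasDivergence U q (divergence U q) := by
  rw [divergence, dif_pos h]
  exact h.choose_spec

theorem IsPolygonalDomain.isFiniteMeasure (hΩ : IsPolygonalDomain Ω) :
    IsFiniteMeasure (volume.restrict Ω) :=
  isFiniteMeasure_restrict.2 hΩ.isBounded.measure_lt_top.ne

/-- A field in `W^{1,∞}` has a bounded distributional divergence. -/
theorem MemW1Inf.exists_hasDivergence [IsFiniteMeasure (volume.restrict Ω)] {b : Plane → Plane}
    (hb : MemW1Inf Ω b) :
    ∃ d, MemLp d ∞ (volume.restrict Ω) ∧ HasDivergence Ω b d := by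
  obtain ⟨hb, D, hD⟩ := hb
  have hd : MemLp (fun x => D 0 0 x + D 1 1 x) ∞ (volume.restrict Ω) := (hD 0 0).1.add (hD 1 1).1
  refine ⟨_, hd, IntegrableOn.locallyIntegrableOn (hd.integrable (by simp)), fun φ hφ => ?_⟩
  have hDi : ∀ i, Integrable (fun x => D i i x * φ x) (volume.restrict Ω) := fun i =>
    ((hD i i).1.integrable_mul (hφ.memLp 1))
  have hbi : ∀ i, Integrable (fun x => b x i * fderiv ℝ φ x (EuclideanSpace.single i 1))
      (volume.restrict Ω) := fun i => by
    have h1 : MemLp (fun x => b x i) ∞ (volume.restrict Ω) :=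
      (EuclideanSpace.proj (𝕜 := ℝ) i).comp_memLp' hb
    have h2 : MemLp (fun x => fderiv ℝ φ x (EuclideanSpace.single i 1)) 1 (volume.restrict Ω) := by
      have := (innerSL ℝ (EuclideanSpace.single i (1 : ℝ))).comp_memLp' (hφ.memLp_gradient 1)
      simpa [Function.comp_def, inner_gradient_right] using this
    exact h1.integrable_mul h2
  have e : ∀ x, ⟪b x, gradient φ x⟫ = b x 0 * fderiv ℝ φ x (EuclideanSpace.single 0 1)
      + b x 1 * fderiv ℝ φ x (EuclideanSpace.single 1 1) := fun x => by
    have hx : b x = b x 0 • EuclideanSpace.single 0 1 + b x 1 • EuclideanSpace.single 1 1 := by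
      ext i; fin_cases i <;> simp
    rw [inner_gradient_right]
    conv_lhs => rw [hx]
    simp
  simp only [e, add_mul]
  rw [integral_add (hDi 0) (hDi 1), integral_add (hbi 0) (hbi 1), (hD 0 0).2 φ hφ,
    (hD 1 1).2 φ hφ]
  ring

theorem MemW1Inf.hasDivergence [IsFiniteMeasure (volume.restrict Ω)] {b : Plane → Plane}
    (hb : MemW1Inf Ω b) : HasDivergence Ω b (divergence Ω b) :=
  let ⟨d, _, h⟩ := hb.exists_hasDivergence
  hasDivergence_divergence ⟨d, h⟩

theorem MemW1Inf.memLp_divergence [IsFiniteMeasure (volume.restrict Ω)] (hΩ : IsOpen Ω)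
    {b : Plane → Plane} (hb : MemW1Inf Ω b) :
    MemLp (divergence Ω b) ∞ (volume.restrict Ω) := by
  obtain ⟨d, hd, h⟩ := hb.exists_hasDivergence
  exact hd.ae_eq (h.ae_eq hΩ hb.hasDivergence)

/-! ### The convection operator -/

/-- Multiplication of `L²(Ω)` by a bounded function. -/
def mulOp (g : Lp ℝ ∞ (volume.restrict Ω)) : L2 Ω →L[ℝ] L2 Ω :=
  (ContinuousLinearMap.mul ℝ ℝ).holderL (volume.restrict Ω) ∞ 2 2 g

/-- The operator `p ↦ b · p` from `L²(Ω)²` to `L²(Ω)`, for a bounded field `b`. -/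
def dotOp (b : Lp Plane ∞ (volume.restrict Ω)) : L2vec Ω →L[ℝ] L2 Ω :=
  (innerSL ℝ (E := Plane)).holderL (volume.restrict Ω) ∞ 2 2 b

theorem coeFn_mulOp (g : Lp ℝ ∞ (volume.restrict Ω)) (f : L2 Ω) :
    mulOp g f =ᵐ[volume.restrict Ω] fun x => g x * f x :=
  (ContinuousLinearMap.mul ℝ ℝ).coeFn_holder g f

theorem coeFn_dotOp (b : Lp Plane ∞ (volume.restrict Ω)) (p : L2vec Ω) :
    dotOp b p =ᵐ[volume.restrict Ω] fun x => ⟪b x, p x⟫ :=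
  (innerSL ℝ (E := Plane)).coeFn_holder b p

theorem norm_mulOp_le (g : Lp ℝ ∞ (volume.restrict Ω)) (f : L2 Ω) : ‖mulOp g f‖ ≤ ‖g‖ * ‖f‖ := by
  refine ((ContinuousLinearMap.mul ℝ ℝ).norm_holder_apply_apply_le g f).trans ?_
  simp

/-- The expanded divergence `d u + b · ∇u` of `b u`, where `d` stands for the divergence of `b`. -/
def convOp (d : Lp ℝ ∞ (volume.restrict Ω)) (b : Lp Plane ∞ (volume.restrict Ω)) :
    L2 Ω × L2vec Ω →L[ℝ] L2 Ω :=
  (mulOp d).coprod (dotOp b)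

theorem convOp_apply (d : Lp ℝ ∞ (volume.restrict Ω)) (b : Lp Plane ∞ (volume.restrict Ω))
    (u : L2 Ω × L2vec Ω) : convOp d b u = mulOp d u.1 + dotOp b u.2 := rfl

theorem coeFn_convOp (d : Lp ℝ ∞ (volume.restrict Ω)) (b : Lp Plane ∞ (volume.restrict Ω))
    (u : L2 Ω × L2vec Ω) :
    convOp d b u =ᵐ[volume.restrict Ω] fun x => d x * u.1 x + ⟪b x, u.2 x⟫ := by
  rw [convOp_apply]
  filter_upwards [Lp.coeFn_add (mulOp d u.1) (dotOp b u.2), coeFn_mulOp d u.1, coeFn_dotOp b u.2]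
    with x h1 h2 h3
  rw [h1, Pi.add_apply, h2, h3]

/-- Green's formula for test functions: this is the definition of the divergence of `b` tested
with the product of the two functions. -/
theorem green_testGraph {d : Lp ℝ ∞ (volume.restrict Ω)} {b : Lp Plane ∞ (volume.restrict Ω)}
    (h : HasDivergence Ω b d) {u v : L2 Ω × L2vec Ω} (hu : u ∈ testGraph Ω)
    (hv : v ∈ testGraph Ω) : ⟪convOp d b u, v.1⟫ + ⟪u.1, dotOp b v.2⟫ = 0 := by
  obtain ⟨φ, hφ, hu1, hu2⟩ := hu
  obtain ⟨ψ, hψ, hv1, hv2⟩ := hv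
  have hχ := hφ.mul hψ
  have hd : Integrable (fun x => d x * (φ x * ψ x)) (volume.restrict Ω) :=
    (Lp.memLp d).integrable_mul (hχ.memLp 1)
  have hb : Integrable (fun x => ⟪b x, gradient (fun y => φ y * ψ y) x⟫) (volume.restrict Ω) :=
    memLp_one_iff_integrable.1
      ((innerSL ℝ (E := Plane)).memLp_of_bilin 1 (Lp.memLp b) (hχ.memLp_gradient 1))
  have e : ∫ x in Ω, (d x * (φ x * ψ x) + ⟪b x, gradient (fun y => φ y * ψ y) x⟫) = 0 := by
    rw [integral_add hd hb, h.2 _ hχ, neg_add_cancel]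
  rw [L2.inner_def, L2.inner_def,
    ← integral_add (L2.integrable_inner _ _) (L2.integrable_inner _ _), ← e]
  refine integral_congr_ae ?_
  filter_upwards [coeFn_convOp d b u, coeFn_dotOp b v.2, hu1, hu2, hv1, hv2]
    with x h1 h2 h3 h4 h5 h6
  rw [h1, h2, h3, h4, h5, h6, hφ.gradient_mul hψ, inner_add_right, real_inner_smul_right,
    real_inner_smul_right]
  simp
  ring

/-- Green's formula on `H¹₀(Ω)`, by density of the test functions. -/
theorem green_H10 {d : Lp ℝ ∞ (volume.restrict Ω)} {b : Lp Plane ∞ (volume.restrict Ω)}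
    (h : HasDivergence Ω b d) (u v : H10 Ω) :
    ⟪convOp d b u, v.1.1⟫ + ⟪u.1.1, dotOp b v.1.2⟫ = 0 := by
  -- extend first in `u`, then in `v`
  have h1 : ∀ v ∈ testGraph Ω, ∀ u ∈ H10 Ω,
      ⟪convOp d b u, v.1⟫ + ⟪u.1, dotOp b v.2⟫ = 0 := fun v hv => by
    have hcl : IsClosed {u : L2 Ω × L2vec Ω | ⟪convOp d b u, v.1⟫ + ⟪u.1, dotOp b v.2⟫ = 0} :=
      isClosed_eq (((convOp d b).continuous.inner continuous_const).add
        (continuous_fst.inner continuous_const)) continuous_const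
    exact closure_minimal (s := (testGraph Ω : Set (L2 Ω × L2vec Ω)))
      (fun u hu => green_testGraph h hu hv) hcl
  have hcl : IsClosed {v : L2 Ω × L2vec Ω |
      ⟪convOp d b u, v.1⟫ + ⟪u.1.1, dotOp b v.2⟫ = 0} :=
    isClosed_eq ((continuous_const.inner continuous_fst).add
      (continuous_const.inner ((dotOp b).continuous.comp continuous_snd))) continuous_const
  exact closure_minimal (s := (testGraph Ω : Set (L2 Ω × L2vec Ω)))
    (fun v hv => h1 v hv u u.2) hcl v.2

/-- The product rule `div (b u) = d u + b · ∇u` on an open subset of `Ω`. -/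
theorem hasDivergence_smul [IsFiniteMeasure (volume.restrict Ω)]
    {d : Lp ℝ ∞ (volume.restrict Ω)} {b : Lp Plane ∞ (volume.restrict Ω)}
    (h : HasDivergence Ω b d) (hK : K ⊆ Ω) {b' : Plane → Plane}
    (hb' : b =ᵐ[volume.restrict Ω] b') (u : H10 Ω) :
    HasDivergence K (fun x => fn u x • b' x) (convOp d b u) := by
  refine ⟨(IntegrableOn.locallyIntegrableOn
    ((Lp.memLp (convOp d b u)).integrable (by norm_num))).mono_set hK, fun φ hφ => ?_⟩
  have hφ' := hφ.mono hK
  -- both integrands vanish outside `K`, so that the integrals may be taken over `Ω`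
  have e : ∀ f : Plane → ℝ, (∀ x ∉ K, f x = 0) → ∫ x in K, f x = ∫ x in Ω, f x := fun f hf => by
    rw [setIntegral_eq_integral_of_forall_compl_eq_zero hf,
      setIntegral_eq_integral_of_forall_compl_eq_zero fun x hx => hf x fun hxK => hx (hK hxK)]
  rw [e _ fun x hx => by rw [hφ.eq_zero_of_notMem hx, mul_zero],
    e _ fun x hx => by rw [hφ.gradient_eq_zero_of_notMem hx, inner_zero_right]]
  have key := green_H10 h u hφ'.toH10
  rw [L2.inner_def, L2.inner_def] at key
  rw [← add_eq_zero_iff_eq_neg, ← key]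
  congr 1
  · refine integral_congr_ae ?_
    filter_upwards [hφ'.fn_toH10] with x hx
    rw [← hx]
    exact mul_comm _ _
  · refine integral_congr_ae ?_
    filter_upwards [hφ'.grad_toH10, hb', coeFn_dotOp b hφ'.toH10.1.2] with x h1 h2 h3
    rw [h3, ← h1, ← h2, real_inner_smul_left]
    exact mul_comm _ _

/-! ### Integration over the cells of a mesh -/

theorem Mesh.isOpen_cell (𝒯 : Mesh Ω) (hK : K ∈ 𝒯.cells) : IsOpen K := by
  rcases 𝒯.isCell K hK with ⟨p, -, rfl⟩ | ⟨p, e, f, -, -, -, rfl⟩ <;> exact isOpen_interior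

theorem Mesh.convex_cell (𝒯 : Mesh Ω) (hK : K ∈ 𝒯.cells) : Convex ℝ K := by
  rcases 𝒯.isCell K hK with ⟨p, -, rfl⟩ | ⟨p, e, f, -, -, -, rfl⟩ <;>
    exact (convex_convexHull ℝ _).interior

/-- The cells fill `Ω` up to a null set, as convex sets have null boundaries. -/
theorem Mesh.biUnion_ae_eq (𝒯 : Mesh Ω) : (⋃ K ∈ 𝒯.cells, K) =ᵐ[volume] Ω := by
  refine Filter.EventuallyLE.antisymm
    (LE.le.eventuallyLE (iUnion₂_subset 𝒯.subset)) ?_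
  have hnull : ∀ᵐ x : Plane, ∀ K ∈ 𝒯.cells, x ∉ frontier K :=
    (Finset.eventually_all 𝒯.cells).2 fun K hK =>
      measure_eq_zero_iff_ae_notMem.1 ((𝒯.convex_cell hK).addHaar_frontier volume)
  filter_upwards [hnull] with x hx hxΩ
  have hx' := subset_closure hxΩ
  rw [← 𝒯.cover] at hx'
  obtain ⟨K, hK, hxK⟩ := mem_iUnion₂.1 hx'
  refine mem_iUnion₂.2 ⟨K, hK, interior_subset ?_⟩
  by_contra hi
  exact hx K hK ⟨hxK, hi⟩

theorem Mesh.sum_setIntegral (𝒯 : Mesh Ω) {f : Plane → ℝ} (hf : IntegrableOn f Ω) :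
    ∑ K ∈ 𝒯.cells, ∫ x in K, f x = ∫ x in Ω, f x := by
  rw [← setIntegral_congr_set 𝒯.biUnion_ae_eq, integral_biUnion_finset (s := fun K => K)]
  · exact fun K hK => (𝒯.isOpen_cell hK).measurableSet
  · exact fun K hK L hL hKL => 𝒯.pairwiseDisjoint K hK L hL hKL
  · exact fun K hK => hf.mono_set (𝒯.subset K hK)

/-- As the normal trace is defined by the Green formula, the weak divergence pairing is the pairing
with the distributional divergence on the cell. -/
theorem weakDivPairing_eq (q : Plane → Plane) (ψ : Plane → ℝ) (ψ' : Plane → Plane) :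
    weakDivPairing K q ψ ψ' = ∫ x in K, divergence K q x * ψ x := by
  rw [weakDivPairing, normalTracePairing]
  ring

/-- On `H¹₀(Ω)`, the weak Galerkin form is the standard form
`ε (∇u, ∇v) + (a u, v) + (d u + b · ∇u, v)`. -/
theorem wgForm_eq [IsFiniteMeasure (volume.restrict Ω)] (𝒯 : Mesh Ω) (ε : ℝ)
    {a : Plane → ℝ} {b : Plane → Plane} {aL dL : Lp ℝ ∞ (volume.restrict Ω)}
    {bL : Lp Plane ∞ (volume.restrict Ω)} (ha : aL =ᵐ[volume.restrict Ω] a)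
    (hb : bL =ᵐ[volume.restrict Ω] b) (h : HasDivergence Ω bL dL) (u v : H10 Ω) :
    wgForm 𝒯 ε a b u v =
      ε * ⟪u.1.2, v.1.2⟫ + ⟪mulOp aL u.1.1, v.1.1⟫ + ⟪convOp dL bL u, v.1.1⟫ := by
  have h1 : ∑ K ∈ 𝒯.cells, ∫ x in K, ⟪grad u x, grad v x⟫ = ⟪u.1.2, v.1.2⟫ := by
    rw [L2.inner_def]
    exact 𝒯.sum_setIntegral (L2.integrable_inner u.1.2 v.1.2)
  have e2 : (fun x => ⟪mulOp aL u.1.1 x, v.1.1 x⟫) =ᵐ[volume.restrict Ω]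
      fun x => a x * fn u x * fn v x := by
    filter_upwards [ha, coeFn_mulOp aL u.1.1] with x hx1 hx2
    rw [hx2, hx1]
    exact mul_comm _ _
  have h2 : ∑ K ∈ 𝒯.cells, ∫ x in K, a x * fn u x * fn v x = ⟪mulOp aL u.1.1, v.1.1⟫ := by
    rw [L2.inner_def, integral_congr_ae e2]
    exact 𝒯.sum_setIntegral ((L2.integrable_inner (mulOp aL u.1.1) v.1.1).congr e2)
  have h3 : ∑ K ∈ 𝒯.cells, weakDivPairing K (fun x => fn u x • b x) (fn v) (grad v)
      = ⟪convOp dL bL u, v.1.1⟫ := by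
    rw [L2.inner_def, ← 𝒯.sum_setIntegral (L2.integrable_inner _ _)]
    refine Finset.sum_congr rfl fun K hK => ?_
    have hdiv := hasDivergence_smul h (𝒯.subset K hK) hb u
    rw [weakDivPairing_eq]
    refine integral_congr_ae ?_
    filter_upwards [(hasDivergence_divergence ⟨_, hdiv⟩).ae_eq (𝒯.isOpen_cell hK) hdiv] with x hx
    rw [hx]
    exact mul_comm _ _
  rw [wgForm, h1, h2, h3]

/-! ### The energy norm and the dual seminorm -/

theorem energyNorm_nonneg (ε : ℝ) (u : H10 Ω) : 0 ≤ energyNorm ε u := Real.sqrt_nonneg _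

theorem energyNorm_sq {ε : ℝ} (hε : 0 < ε) (u : H10 Ω) :
    energyNorm ε u ^ 2 = ε * ‖u.1.2‖ ^ 2 + ‖u.1.1‖ ^ 2 := by
  have h1 : ∫ x in Ω, ‖grad u x‖ ^ 2 = ‖u.1.2‖ ^ 2 := by
    rw [← real_inner_self_eq_norm_sq, L2.inner_def]
    exact integral_congr_ae (Filter.Eventually.of_forall fun x =>
      (real_inner_self_eq_norm_sq (grad u x)).symm)
  have h2 : ∫ x in Ω, fn u x ^ 2 = ‖u.1.1‖ ^ 2 := by
    rw [← real_inner_self_eq_norm_sq, L2.inner_def]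
    exact integral_congr_ae (Filter.Eventually.of_forall fun x => sq (fn u x))
  rw [energyNorm, h1, h2, Real.sq_sqrt (by positivity)]

theorem energyNorm_neg {ε : ℝ} (hε : 0 < ε) (u : H10 Ω) : energyNorm ε (-u) = energyNorm ε u := by
  refine (pow_left_inj₀ (energyNorm_nonneg _ _) (energyNorm_nonneg _ _) two_ne_zero).1 ?_
  rw [energyNorm_sq hε, energyNorm_sq hε]
  simp

theorem energyNorm_pos {ε : ℝ} (hε : 0 < ε) {u : H10 Ω} (hu : u ≠ 0) : 0 < energyNorm ε u := by
  refine (energyNorm_nonneg ε u).lt_of_ne' fun h0 => hu ?_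
  have h := energyNorm_sq hε u
  rw [h0] at h
  have h1 : ‖u.1.1‖ = 0 := by
    have : 0 ≤ ε * ‖u.1.2‖ ^ 2 := by positivity
    exact pow_eq_zero_iff two_ne_zero |>.1 (by nlinarith [sq_nonneg ‖u.1.1‖])
  have h2 : ‖u.1.2‖ = 0 := by
    rw [h1] at h
    have : ε * ‖u.1.2‖ ^ 2 = 0 := by linarith
    simpa [hε.ne'] using this
  exact Subtype.ext (Prod.ext (norm_eq_zero.1 h1) (norm_eq_zero.1 h2))

/-- The Cauchy–Schwarz inequality for the inner product `ε (∇u, ∇v) + (u, v)`, up to the bounded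
coefficient of the second term. -/
theorem energy_pairing_le {ε : ℝ} (hε : 0 < ε) {g : Lp ℝ ∞ (volume.restrict Ω)} {A : ℝ}
    (hg : ‖g‖ ≤ A) (u v : H10 Ω) :
    ε * ⟪u.1.2, v.1.2⟫ + ⟪mulOp g u.1.1, v.1.1⟫ ≤
      (1 + A) * (energyNorm ε u * energyNorm ε v) := by
  have hA : 0 ≤ A := (norm_nonneg g).trans hg
  have hs : √ε * √ε = ε := Real.mul_self_sqrt hε.le
  have h1 : ∀ w : H10 Ω, √ε * ‖w.1.2‖ ≤ energyNorm ε w := fun w => by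
    refine abs_le_of_sq_le_sq' ?_ (energyNorm_nonneg ε w) |>.2
    rw [energyNorm_sq hε, mul_pow, Real.sq_sqrt hε.le]
    nlinarith [sq_nonneg ‖w.1.1‖]
  have h2 : ∀ w : H10 Ω, ‖w.1.1‖ ≤ energyNorm ε w := fun w => by
    refine abs_le_of_sq_le_sq' ?_ (energyNorm_nonneg ε w) |>.2
    rw [energyNorm_sq hε]
    have : 0 ≤ ε * ‖w.1.2‖ ^ 2 := by positivity
    linarith
  have h3 : ε * ⟪u.1.2, v.1.2⟫ ≤ energyNorm ε u * energyNorm ε v := by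
    calc ε * ⟪u.1.2, v.1.2⟫ ≤ ε * (‖u.1.2‖ * ‖v.1.2‖) := by
          gcongr; exact real_inner_le_norm _ _
      _ = (√ε * ‖u.1.2‖) * (√ε * ‖v.1.2‖) := by rw [mul_mul_mul_comm, hs]
      _ ≤ _ := mul_le_mul (h1 u) (h1 v) (by positivity) (energyNorm_nonneg ε u)
  have h4 : ⟪mulOp g u.1.1, v.1.1⟫ ≤ A * (energyNorm ε u * energyNorm ε v) := by
    calc ⟪mulOp g u.1.1, v.1.1⟫ ≤ ‖mulOp g u.1.1‖ * ‖v.1.1‖ := real_inner_le_norm _ _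
      _ ≤ (A * ‖u.1.1‖) * ‖v.1.1‖ := by
          gcongr; exact (norm_mulOp_le g u.1.1).trans (by gcongr)
      _ = A * (‖u.1.1‖ * ‖v.1.1‖) := by ring
      _ ≤ _ := by
          gcongr
          · exact energyNorm_nonneg ε u
          · exact h2 u
          · exact h2 v
  linarith

/-- The dual seminorm is nonnegative, since the functionals it compares are odd. -/
theorem starSeminorm_nonneg (ε : ℝ) (q : Plane → Plane) {u : H10 Ω} (hu : u ≠ 0) :
    0 ≤ starSeminorm Ω ε q := by
  refine Real.iSup_nonneg' ?_
  rcases le_total 0 (∫ x in Ω, ⟪q x, grad u x⟫) with h | h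
  · exact ⟨⟨u, hu⟩, div_nonneg h (energyNorm_nonneg ε u)⟩
  · refine ⟨⟨-u, neg_ne_zero.2 hu⟩, div_nonneg ?_ (energyNorm_nonneg ε _)⟩
    have : ∫ x in Ω, ⟪q x, grad (-u) x⟫ = - ∫ x in Ω, ⟪q x, grad u x⟫ := by
      rw [← integral_neg]
      refine integral_congr_ae ?_
      filter_upwards [Lp.coeFn_neg u.1.2] with x hx
      have : grad (-u) x = - grad u x := hx
      rw [this, inner_neg_right]
    simpa [this] using h

theorem integral_smul_inner_grad {b : Plane → Plane} {bL : Lp Plane ∞ (volume.restrict Ω)}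
    (hb : bL =ᵐ[volume.restrict Ω] b) (u w : H10 Ω) :
    ∫ x in Ω, ⟪fn u x • b x, grad w x⟫ = ⟪u.1.1, dotOp bL w.1.2⟫ := by
  rw [L2.inner_def]
  refine integral_congr_ae ?_
  filter_upwards [hb, coeFn_dotOp bL w.1.2] with x h1 h2
  rw [h2, h1, real_inner_smul_left]
  exact mul_comm _ _

/-! ### Coercivity and the inf-sup inequality -/

/-- By Green's formula the convection term contributes `½ (d u, u)` to the quadratic form. -/
theorem inner_convOp_self {d : Lp ℝ ∞ (volume.restrict Ω)} {b : Lp Plane ∞ (volume.restrict Ω)}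
    (h : HasDivergence Ω b d) (u : H10 Ω) :
    ⟪convOp d b u, u.1.1⟫ = 1 / 2 * ⟪mulOp d u.1.1, u.1.1⟫ := by
  have hgreen := green_H10 h u u
  have e : ⟪convOp d b u, u.1.1⟫ = ⟪mulOp d u.1.1, u.1.1⟫ + ⟪dotOp b u.1.2, u.1.1⟫ := by
    rw [convOp_apply, inner_add_left]
  have e' := real_inner_comm u.1.1 (dotOp b u.1.2)
  linarith

theorem coercive {ε c₀ : ℝ} (hε : 0 < ε) {a d : Lp ℝ ∞ (volume.restrict Ω)}
    {b : Lp Plane ∞ (volume.restrict Ω)} (h : HasDivergence Ω b d)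
    (hc : ∀ᵐ x ∂(volume.restrict Ω), c₀ ≤ 1 / 2 * d x + a x) (u : H10 Ω) :
    min 1 c₀ * energyNorm ε u ^ 2 ≤
      ε * ⟪u.1.2, u.1.2⟫ + ⟪mulOp a u.1.1, u.1.1⟫ + ⟪convOp d b u, u.1.1⟫ := by
  have key : c₀ * ‖u.1.1‖ ^ 2 ≤ ⟪mulOp a u.1.1, u.1.1⟫ + 1 / 2 * ⟪mulOp d u.1.1, u.1.1⟫ := by
    rw [← real_inner_self_eq_norm_sq, L2.inner_def, L2.inner_def, L2.inner_def,
      ← integral_const_mul, ← integral_const_mul,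
      ← integral_add (L2.integrable_inner _ _) ((L2.integrable_inner _ _).const_mul _)]
    refine integral_mono_ae ((L2.integrable_inner _ _).const_mul _)
      ((L2.integrable_inner _ _).add ((L2.integrable_inner _ _).const_mul _)) ?_
    filter_upwards [hc, coeFn_mulOp a u.1.1, coeFn_mulOp d u.1.1] with x h1 h2 h3
    rw [h2, h3]
    -- the inner product of `ℝ` unfolds to multiplication
    have hin : ∀ s t : ℝ, ⟪s, t⟫ = t * s := fun s t => rfl
    simp only [hin]
    nlinarith [mul_le_mul_of_nonneg_right h1 (mul_self_nonneg (u.1.1 x))]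
  rw [inner_convOp_self h, energyNorm_sq hε, real_inner_self_eq_norm_sq, mul_add]
  have h1 : min 1 c₀ * (ε * ‖u.1.2‖ ^ 2) ≤ ε * ‖u.1.2‖ ^ 2 :=
    mul_le_of_le_one_left (by positivity) (min_le_left _ _)
  have h2 : min 1 c₀ * ‖u.1.1‖ ^ 2 ≤ c₀ * ‖u.1.1‖ ^ 2 := by
    gcongr; exact min_le_right _ _
  linarith

/-- If `a_h(u, v) ≤ S |||v|||` for all `v`, then `S` controls both terms of the norm of `u`. -/
theorem energyNorm_add_starSeminorm_le [IsFiniteMeasure (volume.restrict Ω)] (𝒯 : Mesh Ω)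
    {ε c₀ A S : ℝ} (hε : 0 < ε) (hc₀ : 0 < c₀) {a : Plane → ℝ} {b : Plane → Plane}
    {aL dL : Lp ℝ ∞ (volume.restrict Ω)} {bL : Lp Plane ∞ (volume.restrict Ω)}
    (ha : aL =ᵐ[volume.restrict Ω] a) (hA : ‖aL‖ ≤ A)
    (hb : bL =ᵐ[volume.restrict Ω] b) (h : HasDivergence Ω bL dL)
    (hc : ∀ᵐ x ∂(volume.restrict Ω), c₀ ≤ 1 / 2 * dL x + aL x) {u : H10 Ω} (hu : u ≠ 0)
    (hS : ∀ v : H10 Ω, v ≠ 0 → wgForm 𝒯 ε a b u v ≤ S * energyNorm ε v) :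
    energyNorm ε u + starSeminorm Ω ε (fun x => fn u x • b x) ≤
      ((2 + A) / min 1 c₀ + 1) * S := by
  have hm : 0 < min 1 c₀ := lt_min one_pos hc₀
  have hA0 : 0 ≤ A := (norm_nonneg aL).trans hA
  have hpos := energyNorm_pos hε hu
  have h1 : energyNorm ε u ≤ S / min 1 c₀ := by
    rw [le_div_iff₀ hm]
    refine le_of_mul_le_mul_right ?_ hpos
    have hco := coercive hε h hc u
    rw [← wgForm_eq 𝒯 ε ha hb h] at hco
    nlinarith [hS u hu]
  have h2 : starSeminorm Ω ε (fun x => fn u x • b x) ≤ (1 + A) * energyNorm ε u + S := by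
    have : Nonempty {w : H10 Ω // w ≠ 0} := ⟨⟨u, hu⟩⟩
    refine ciSup_le fun ⟨w, hw⟩ => ?_
    rw [div_le_iff₀ (energyNorm_pos hε hw), integral_smul_inner_grad hb]
    -- the form at `-w` contains `(b u, ∇w)` with a positive sign
    have hform := hS (-w) (neg_ne_zero.2 hw)
    rw [wgForm_eq 𝒯 ε ha hb h, energyNorm_neg hε] at hform
    simp only [Submodule.coe_neg, Prod.fst_neg, Prod.snd_neg, inner_neg_right] at hform
    have hgreen := green_H10 h u w
    have hcs := energy_pairing_le hε hA u w
    nlinarith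
  calc energyNorm ε u + starSeminorm Ω ε (fun x => fn u x • b x)
      ≤ (2 + A) * energyNorm ε u + S := by linarith
    _ ≤ (2 + A) * (S / min 1 c₀) + S := by gcongr
    _ = _ := by ring

end ConvDiff

end

theorem mainTheorem3 (c₀ A : ℝ) (hc₀ : 0 < c₀) :
    ∃ C : ℝ, 0 < C ∧
      ∀ (Ω : Set ConvDiff.Plane), ConvDiff.IsPolygonalDomain Ω →
      ∀ (a : ConvDiff.Plane → ℝ) (b : ConvDiff.Plane → ConvDiff.Plane),
        MemLp a ∞ (volume.restrict Ω) →
        eLpNorm a ∞ (volume.restrict Ω) ≤ ENNReal.ofReal A →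
        ConvDiff.MemW1Inf Ω b →
        (∀ᵐ x ∂(volume.restrict Ω), c₀ ≤ 1 / 2 * ConvDiff.divergence Ω b x + a x) →
      ∀ (ε : ℝ), 0 < ε → ∀ (𝒯 : ConvDiff.Mesh Ω),
        (C : EReal) ≤
          ⨅ u : {u : ConvDiff.H10 Ω // u ≠ 0}, ⨆ v : {v : ConvDiff.H10 Ω // v ≠ 0},
            ((ConvDiff.wgForm 𝒯 ε a b u.1 v.1 /
              ((ConvDiff.energyNorm ε u.1
                  + ConvDiff.starSeminorm Ω ε (fun x => ConvDiff.fn u.1 x • b x))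
                * ConvDiff.energyNorm ε v.1) : ℝ) : EReal) := by
  have hm : 0 < min 1 c₀ := lt_min one_pos hc₀
  set M : ℝ := (2 + max A 0) / min 1 c₀ + 1 with hM
  have hMpos : 0 < M := by positivity
  -- `M` is the constant of `energyNorm_add_starSeminorm_le`; the factor `2` makes the
  -- contradiction below follow from a non-strict bound on the quotients
  refine ⟨1 / (2 * M), by positivity, fun Ω hΩ a b ha hA hb hc ε hε 𝒯 => le_iInf fun ⟨u, hu⟩ => ?_⟩
  have := hΩ.isFiniteMeasure
  by_contra! hlt
  have hd := hb.memLp_divergence hΩ.isOpen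
  set N : ℝ := ConvDiff.energyNorm ε u
    + ConvDiff.starSeminorm Ω ε (fun x => ConvDiff.fn u x • b x) with hN
  have hNpos : 0 < N :=
    add_pos_of_pos_of_nonneg (ConvDiff.energyNorm_pos hε hu)
      (ConvDiff.starSeminorm_nonneg ε _ hu)
  have hS : ∀ v : ConvDiff.H10 Ω, v ≠ 0 →
      ConvDiff.wgForm 𝒯 ε a b u v ≤ (1 / (2 * M) * N) * ConvDiff.energyNorm ε v := by
    intro v hv
    have hle := (le_iSup (fun v : {v : ConvDiff.H10 Ω // v ≠ 0} =>
      ((ConvDiff.wgForm 𝒯 ε a b u v.1 / (N * ConvDiff.energyNorm ε v.1) : ℝ) : EReal))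
      ⟨v, hv⟩).trans hlt.le
    rw [EReal.coe_le_coe_iff, div_le_iff₀ (mul_pos hNpos (ConvDiff.energyNorm_pos hε hv))] at hle
    linarith
  have hnorm : ‖ha.toLp a‖ ≤ max A 0 := by
    rw [Lp.norm_toLp]
    refine ENNReal.toReal_le_of_le_ofReal (le_max_right _ _) (hA.trans ?_)
    exact ENNReal.ofReal_le_ofReal (le_max_left _ _)
  have hdiv : ConvDiff.HasDivergence Ω (hb.1.toLp b) (hd.toLp _) :=
    hb.hasDivergence.congr hb.1.coeFn_toLp.symm hd.coeFn_toLp.symm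
      ((Lp.memLp (hd.toLp _)).integrable (by simp))
  have hc' : ∀ᵐ x ∂(volume.restrict Ω), c₀ ≤ 1 / 2 * (hd.toLp _) x + (ha.toLp a) x := by
    filter_upwards [hc, hd.coeFn_toLp, ha.coeFn_toLp] with x h1 h2 h3
    rw [h2, h3]
    exact h1
  have hfin := ConvDiff.energyNorm_add_starSeminorm_le 𝒯 hε hc₀ ha.coeFn_toLp hnorm
    hb.1.coeFn_toLp hdiv hc' hu hS
  rw [← hM, ← hN] at hfin
  have : M * (1 / (2 * M) * N) = N / 2 := by field_simp
  linarith
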